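/- All Hilbert spaces are complex, not necessarily separable, and all operators are everywhere defined and bounded. The dimension of a Hilbert space is the cardinality of an orthonormal (Hilbert) basis. For a selfadjoint operator $C$ on a Hilbert space $\mathcal H$, a subspace $\mathcal M\subseteq\mathcal H$ is called $C$-strictly positive (respectively negative) if $\langle Cf,f\rangle>0$ (respectively $<0$) for every nonzero $f\in\mathcal M$. The hermitian index $h_+(C)$ (respectively $h_-(C)$) is the maximum dimension of a closed $C$-strictly positive (respectively negative) subspace of $\mathcal H$. A signature operator is an operator that is both selfadjoint and unitary. **Theorem.** Let $\mathcal H$ and $\mathcal K$ be Hilbert spaces and let $C$ be a selfadjoint operator on $\mathcal H$ with $\ker C=\{0\}$. Suppose $C=T^*J_AT$, where $J_A$ is a signature operator on $\mathcal K$ and $T\colon\mathcal H\to\mathcal K$ is a bounded operator with $\ker T=\{0\}$ and dense range. Then the maxima defining $h_\pm(C)$ and $h_\pm(J_A)$ are attained, and, as cardinal numbers, $$h_+(C)=h_+(J_A)\qquad\text{and}\qquad h_-(C)=h_-(J_A).$$ -/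

import Mathlib

universe u v w

namespace HermitianIndices

open Cardinal

/-- The cardinality of a Hilbert basis does not exceed that of another one. -/
theorem mk_le_of_hilbertBasis {E : Type u} [NormedAddCommGroup E] [InnerProductSpace ℂ E]
    {ι : Type v} {κ : Type w} (b : HilbertBasis ι ℂ E) (c : HilbertBasis κ ℂ E) :
    lift.{w} #ι ≤ lift.{v} #κ := by
  classical
  rcases finite_or_infinite κ with hκ | hκ
  · have := Fintype.ofFinite κ
    have h1 := b.orthonormal.linearIndependent.cardinal_lift_le_rank
    have h2 := c.toOrthonormalBasis.toBasis.mk_eq_rank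
    have h3 := lift_le.{w}.2 h1
    have h4 := congrArg lift.{v} h2
    simp only [lift_lift] at h3 h4
    rw [← lift_le.{u}]
    simp only [lift_lift]
    have e : lift.{max w v} (Module.rank ℂ E) = lift.{max v w} (Module.rank ℂ E) := rfl
    calc _ = lift.{max u w} #ι := rfl
      _ ≤ _ := h3
      _ = _ := h4.symm
  · have hcount (j : κ) : {i : ι | inner ℂ (b i) (c j) ≠ 0}.Countable := by
      have h := (b.orthonormal.inner_products_summable (c j)).countable_support
      refine h.mono fun i hi => ?_
      simpa [Function.mem_support] using hi
    have hcover : (⋃ j, {i : ι | inner ℂ (b i) (c j) ≠ 0}) = Set.univ := by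
      refine Set.eq_univ_of_forall fun i => ?_
      by_contra hi
      have hz (j : κ) : inner ℂ (b i) (c j) = 0 := by
        by_contra hj
        exact hi (Set.mem_iUnion.2 ⟨j, hj⟩)
      have hr : c.repr (b i) = 0 := by
        ext j
        rw [c.repr_apply_apply, inner_eq_zero_symm.1 (hz j)]
        rfl
      have hb : b i = 0 := by simpa using hr
      exact b.orthonormal.ne_zero i hb
    have hle := mk_iUnion_le_lift (fun j => {i : ι | inner ℂ (b i) (c j) ≠ 0})
    rw [hcover, mk_univ] at hle
    refine hle.trans ?_
    have hsup : (⨆ j, lift.{w} #{i : ι | inner ℂ (b i) (c j) ≠ 0}) ≤ ℵ₀ :=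
      ciSup_le' fun j => lift_le_aleph0.2 (le_aleph0_iff_set_countable.2 (hcount j))
    refine (mul_le_mul_right hsup _).trans ?_
    rw [mul_aleph0_eq]
    simp

/-- The dimension of a Hilbert space: the cardinality of an orthonormal (Hilbert) basis. All such
bases of a given Hilbert space have the same cardinality (see `mk_eq_hilbertDim`), and at least one
exists (`exists_hilbertBasis`), so the infimum is a formal way to name the common value. -/
noncomputable def hilbertDim (E : Type u) [NormedAddCommGroup E] [InnerProductSpace ℂ E] :
    Cardinal.{u} :=
  sInf {d | ∃ ι : Type u, Nonempty (HilbertBasis ι ℂ E) ∧ #ι = d}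

/-- Every Hilbert basis of a Hilbert space has cardinality `hilbertDim`. -/
theorem mk_eq_hilbertDim {E : Type u} [NormedAddCommGroup E] [InnerProductSpace ℂ E]
    [CompleteSpace E] {ι : Type v} (b : HilbertBasis ι ℂ E) :
    lift.{u} #ι = lift.{v} (hilbertDim E) := by
  obtain ⟨s, b₀, -⟩ := exists_hilbertBasis ℂ E
  have hne : {d | ∃ ι : Type u, Nonempty (HilbertBasis ι ℂ E) ∧ #ι = d}.Nonempty :=
    ⟨#s, s, ⟨b₀⟩, rfl⟩
  obtain ⟨κ, ⟨c⟩, hc⟩ := csInf_mem hne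
  have hd : hilbertDim E = #κ := hc.symm
  rw [hd]
  exact le_antisymm (mk_le_of_hilbertBasis b c) (mk_le_of_hilbertBasis c b)

section Indices

variable {H : Type u} [NormedAddCommGroup H] [InnerProductSpace ℂ H]

/-- `M` is `C`-strictly positive: `⟨C f, f⟩ > 0` for every nonzero `f ∈ M`. For selfadjoint `C` the
number `⟨C f, f⟩` is real. -/
def IsStrictlyPos (C : H →L[ℂ] H) (M : Submodule ℂ H) : Prop :=
  ∀ f ∈ M, f ≠ 0 → 0 < (inner ℂ (C f) f).re

/-- `M` is `C`-strictly negative: `⟨C f, f⟩ < 0` for every nonzero `f ∈ M`. -/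
def IsStrictlyNeg (C : H →L[ℂ] H) (M : Submodule ℂ H) : Prop :=
  ∀ f ∈ M, f ≠ 0 → (inner ℂ (C f) f).re < 0

/-- The dimensions of the closed `C`-strictly positive subspaces. -/
def posDims (C : H →L[ℂ] H) : Set Cardinal.{u} :=
  {d | ∃ M : Submodule ℂ H, IsClosed (M : Set H) ∧ IsStrictlyPos C M ∧ hilbertDim M = d}

/-- The dimensions of the closed `C`-strictly negative subspaces. -/
def negDims (C : H →L[ℂ] H) : Set Cardinal.{u} :=
  {d | ∃ M : Submodule ℂ H, IsClosed (M : Set H) ∧ IsStrictlyNeg C M ∧ hilbertDim M = d}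

/-- The positive hermitian index `h₊(C)`: the maximum dimension of a closed `C`-strictly positive
subspace. It is written as a supremum; that the maximum is attained is expressed by
`IsGreatest (posDims C) (posIndex C)`. -/
noncomputable def posIndex (C : H →L[ℂ] H) : Cardinal.{u} := sSup (posDims C)

/-- The negative hermitian index `h₋(C)`: the maximum dimension of a closed `C`-strictly negative
subspace. -/
noncomputable def negIndex (C : H →L[ℂ] H) : Cardinal.{u} := sSup (negDims C)

/-- A signature operator on a Hilbert space: selfadjoint and unitary. -/
def IsSignatureOperator [CompleteSpace H] (J : H →L[ℂ] H) : Prop :=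
  IsSelfAdjoint J ∧ J ∈ unitary (H →L[ℂ] H)

end Indices

end HermitianIndices

/-! For an injective selfadjoint `C`, the form is strictly positive on `P = ker C⁻` and nonpositive
on `Pᗮ`. Orthogonal projection onto `P` is therefore injective on every strictly positive subspace,
so `dim P` is the maximum. Let `Q` be the analogous space for `J`.

`T` carries the form of `C` to that of `J`, so projecting `T P` to `Q` is injective and `dim P ≤ dim
Q`. The reverse cannot simply use the inverse of `T`, which may be unbounded. Instead
`exists_family_nonpos` finds `dim P` vectors on whose orthogonal complement `J` is nonpositive;
their projections are total in `Q`, so `dim Q ≤ dim P`. If `P` is finite-dimensional, a basis of `J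
T P` serves (`nonpos_of_finiteDimensional`). Otherwise a basis of `P` is mapped by `T` and closed up
under countably many words involving `T T*`, which leaves its cardinality unchanged
(`nonpos_of_invariant`). -/

namespace HermitianIndices

open Cardinal ContinuousLinearMap

/-! ### Comparison of Hilbert dimensions -/

/-- A total family in a Hilbert space has at least as many members as a Hilbert basis. -/
theorem mk_le_of_total {E : Type u} [NormedAddCommGroup E] [InnerProductSpace ℂ E]
    {ι : Type v} {κ : Type w} (b : HilbertBasis ι ℂ E) (x : κ → E)
    (hx : ∀ e : E, (∀ j, inner ℂ (x j) e = 0) → e = 0) :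
    lift.{w} #ι ≤ lift.{v} #κ := by
  classical
  rcases finite_or_infinite κ with hκ | hκ
  · have := Fintype.ofFinite κ
    let L : E →ₗ[ℂ] (κ → ℂ) := LinearMap.pi fun j => (innerSL ℂ (x j)).toLinearMap
    have hL : Function.Injective L := by
      rw [injective_iff_map_eq_zero]
      exact fun e he => hx e fun j => congrFun he j
    have hli : LinearIndependent ℂ (fun i => L (b i)) :=
      b.orthonormal.linearIndependent.map' L (LinearMap.ker_eq_bot.2 hL)
    have : Finite ι := hli.finite
    have := Fintype.ofFinite ι
    have h := hli.fintype_card_le_finrank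
    rw [Module.finrank_fintype_fun_eq_card] at h
    simpa using h
  -- By Bessel each `x j` meets only countably many `b i`, and by totality every `b i` is met, so
  -- `#ι ≤ #κ * ℵ₀ = #κ`.
  · have hcount (j : κ) : {i : ι | inner ℂ (b i) (x j) ≠ 0}.Countable := by
      have h := (b.orthonormal.inner_products_summable (x j)).countable_support
      refine h.mono fun i hi => ?_
      simpa [Function.mem_support] using hi
    have hcover : (⋃ j, {i : ι | inner ℂ (b i) (x j) ≠ 0}) = Set.univ := by
      refine Set.eq_univ_of_forall fun i => ?_
      by_contra hi
      refine b.orthonormal.ne_zero i (hx _ fun j => inner_eq_zero_symm.1 ?_)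
      by_contra hj
      exact hi (Set.mem_iUnion.2 ⟨j, hj⟩)
    have hle := mk_iUnion_le_lift (fun j => {i : ι | inner ℂ (b i) (x j) ≠ 0})
    rw [hcover, mk_univ] at hle
    refine hle.trans ?_
    have hsup : (⨆ j, lift.{w} #{i : ι | inner ℂ (b i) (x j) ≠ 0}) ≤ ℵ₀ :=
      ciSup_le' fun j => lift_le_aleph0.2 (le_aleph0_iff_set_countable.2 (hcount j))
    refine (mul_le_mul_right hsup _).trans ?_
    rw [mul_aleph0_eq]
    simp

/-- A Hilbert basis realising `hilbertDim`. -/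
theorem exists_hilbertBasis_mk_eq (E : Type u) [NormedAddCommGroup E] [InnerProductSpace ℂ E]
    [CompleteSpace E] :
    ∃ ι : Type u, ∃ _ : HilbertBasis ι ℂ E, #ι = hilbertDim E := by
  obtain ⟨s, b, -⟩ := exists_hilbertBasis ℂ E
  exact ⟨s, b, by simpa using mk_eq_hilbertDim b⟩

theorem hilbertDim_le_of_total {E : Type u} [NormedAddCommGroup E] [InnerProductSpace ℂ E]
    [CompleteSpace E] {κ : Type w} (x : κ → E)
    (hx : ∀ e : E, (∀ j, inner ℂ (x j) e = 0) → e = 0) :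
    lift.{w} (hilbertDim E) ≤ lift.{u} #κ := by
  obtain ⟨ι, b, hb⟩ := exists_hilbertBasis_mk_eq E
  exact hb ▸ mk_le_of_total b x hx

/-- Hilbert dimension is monotone along injective bounded operators. -/
theorem hilbertDim_le_of_injective {E : Type u} [NormedAddCommGroup E] [InnerProductSpace ℂ E]
    [CompleteSpace E] {F : Type v} [NormedAddCommGroup F] [InnerProductSpace ℂ F]
    [CompleteSpace F] (A : E →L[ℂ] F) (hA : ∀ e, A e = 0 → e = 0) :
    lift.{v} (hilbertDim E) ≤ lift.{u} (hilbertDim F) := by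
  obtain ⟨κ, c, hc⟩ := exists_hilbertBasis_mk_eq F
  rw [← hc]
  -- The family `A* c_j` is total exactly because `A` is injective.
  refine hilbertDim_le_of_total (fun j => adjoint A (c j)) fun e he => hA e ?_
  have hr : c.repr (A e) = 0 := by
    ext j
    rw [c.repr_apply_apply, ← adjoint_inner_left, he j]
    rfl
  simpa using hr

section Neg

variable {H : Type u} [NormedAddCommGroup H] [InnerProductSpace ℂ H]

theorem negDims_eq_posDims_neg (C : H →L[ℂ] H) : negDims C = posDims (-C) := by
  simp [negDims, posDims, IsStrictlyNeg, IsStrictlyPos]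

theorem negIndex_eq_posIndex_neg (C : H →L[ℂ] H) : negIndex C = posIndex (-C) := by
  rw [negIndex, posIndex, negDims_eq_posDims_neg]

end Neg

/-! ### Spectral splitting and maximal strictly positive subspaces -/

section Form

variable {H : Type u} [NormedAddCommGroup H] [InnerProductSpace ℂ H] [CompleteSpace H]

theorem IsSelfAdjoint.inner_left_eq {C : H →L[ℂ] H} (hC : IsSelfAdjoint C) (x y : H) :
    inner ℂ (C x) y = inner ℂ x (C y) :=
  hC.isSymmetric x y

theorem apply_eq_zero_of_nonneg {P : H →L[ℂ] H} (hP : 0 ≤ P) {f : H}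
    (hf : (inner ℂ (P f) f).re ≤ 0) : P f = 0 := by
  obtain ⟨s, rfl⟩ := CStarAlgebra.nonneg_iff_eq_star_mul_self.1 hP
  have h : (inner ℂ ((star s * s) f) f).re = ‖s f‖ ^ 2 := by
    rw [mul_apply_eq_comp, star_eq_adjoint, adjoint_inner_left]
    exact inner_self_eq_norm_sq (𝕜 := ℂ) (s f)
  have h0 : s f = 0 := by
    rw [h] at hf
    simpa using le_antisymm hf (sq_nonneg _)
  rw [mul_apply_eq_comp, h0, map_zero]

/-- The positive spectral subspace of an injective selfadjoint operator. -/
theorem exists_positive_spectral_subspace {C : H →L[ℂ] H} (hC : IsSelfAdjoint C)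
    (hker : ∀ f, C f = 0 → f = 0) :
    ∃ P : Submodule ℂ H, IsClosed (P : Set H) ∧ (∀ f ∈ P, C f ∈ P) ∧ IsStrictlyPos C P ∧
      ∀ f ∈ Pᗮ, (inner ℂ (C f) f).re ≤ 0 := by
  have hp : 0 ≤ C⁺ := CFC.posPart_nonneg C
  have hn : 0 ≤ C⁻ := CFC.negPart_nonneg C
  have hsub (f : H) : C f = C⁺ f - C⁻ f := by
    conv_lhs => rw [← CFC.posPart_sub_negPart C hC]
    rfl
  have hnp (f : H) : C⁻ (C⁺ f) = 0 := DFunLike.congr_fun (CFC.negPart_mul_posPart C) f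
  have hpos (f : H) : 0 ≤ (inner ℂ (C⁺ f) f).re :=
    ((nonneg_iff_isPositive _).1 hp).re_inner_nonneg_left f
  have hneg (f : H) : 0 ≤ (inner ℂ (C⁻ f) f).re :=
    ((nonneg_iff_isPositive _).1 hn).re_inner_nonneg_left f
  -- On `ker C⁻`, `C` agrees with `C⁺`, and injectivity makes the form strict. Since `C⁻ C⁺ = 0`,
  -- the range of `C⁺` lies in `ker C⁻`, so `C⁺` vanishes on the orthogonal complement.
  refine ⟨LinearMap.ker C⁻.toLinearMap, C⁻.isClosed_ker, fun f hf => ?_, fun f hf hf0 => ?_,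
    fun f hf => ?_⟩
  · have hf' : C⁻ f = 0 := hf
    change C⁻ (C f) = 0
    rw [hsub, hf', sub_zero, hnp]
  · have hf' : C⁻ f = 0 := hf
    have hCf : C f = C⁺ f := by rw [hsub, hf', sub_zero]
    by_contra h
    rw [hCf, not_lt] at h
    exact hf0 (hker f (hCf.trans (apply_eq_zero_of_nonneg hp h)))
  · have h0 : C⁺ f = 0 := by
      rw [← inner_self_eq_zero (𝕜 := ℂ), ← IsSelfAdjoint.inner_left_eq hp.isSelfAdjoint]
      exact hf _ (hnp _)
    rw [hsub, h0, zero_sub, inner_neg_left, Complex.neg_re]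
    linarith [hneg f]

/-- A closed strictly positive subspace is no larger than any family of vectors on whose
orthogonal complement the form is nonpositive. -/
theorem hilbertDim_le_of_nonpos {C : H →L[ℂ] H} {M : Submodule ℂ H} (hM : IsClosed (M : Set H))
    (hpos : IsStrictlyPos C M) {κ : Type w} (x : κ → H)
    (hx : ∀ f, (∀ j, inner ℂ (x j) f = 0) → (inner ℂ (C f) f).re ≤ 0) :
    lift.{w} (hilbertDim M) ≤ lift.{u} #κ := by
  have := hM.completeSpace_coe
  -- A nonzero vector of `M` orthogonal to all these projections would be orthogonal to all `x j`,
  -- contradicting strict positivity.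
  refine hilbertDim_le_of_total (fun j => M.orthogonalProjectionOnto (x j)) fun e he => ?_
  by_contra h0
  refine (hpos e e.2 (by simpa using h0)).not_ge (hx e fun j => ?_)
  rw [← he j, Submodule.inner_orthogonalProjectionOnto_eq_of_mem_right]

/-- A bounded map carrying the form of `C` to that of `J` compares strictly positive subspaces
with the positive spectral subspace. -/
theorem hilbertDim_le_of_form_le {K : Type v} [NormedAddCommGroup K] [InnerProductSpace ℂ K]
    [CompleteSpace K] {C : H →L[ℂ] H} {J : K →L[ℂ] K} (T : H →L[ℂ] K)
    (hT : ∀ f, (inner ℂ (C f) f).re ≤ (inner ℂ (J (T f)) (T f)).re)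
    {P : Submodule ℂ K} (hP : IsClosed (P : Set K))
    (hneg : ∀ f ∈ Pᗮ, (inner ℂ (J f) f).re ≤ 0)
    {M : Submodule ℂ H} (hM : IsClosed (M : Set H)) (hpos : IsStrictlyPos C M) :
    lift.{v} (hilbertDim M) ≤ lift.{u} (hilbertDim P) := by
  have := hM.completeSpace_coe
  have := hP.completeSpace_coe
  refine hilbertDim_le_of_injective (P.orthogonalProjectionOnto ∘L T ∘L M.subtypeL) fun e he => ?_
  by_contra h0
  refine (hpos e e.2 (by simpa using h0)).not_ge ((hT e).trans (hneg _ ?_))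
  exact Submodule.orthogonalProjectionOnto_eq_zero_iff.1 he

theorem isGreatest_posDims {C : H →L[ℂ] H} {P : Submodule ℂ H} (hP : IsClosed (P : Set H))
    (hpos : IsStrictlyPos C P) (hneg : ∀ f ∈ Pᗮ, (inner ℂ (C f) f).re ≤ 0) :
    IsGreatest (posDims C) (hilbertDim P) := by
  refine ⟨⟨P, hP, hpos, rfl⟩, ?_⟩
  rintro _ ⟨M, hM, hMpos, rfl⟩
  simpa using hilbertDim_le_of_form_le (C := C) (J := C) (ContinuousLinearMap.id ℂ H)
    (fun f => le_rfl) hP hneg hM hMpos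

end Form

/-! ### Orbits of a family under words in two operators -/

section Orbit

variable {K : Type v} [NormedAddCommGroup K] [InnerProductSpace ℂ K]

/-- The product of the operators `J` and `A` spelled by a word, applied to a vector. -/
def wordApply (J A : K →L[ℂ] K) (l : List Bool) (k : K) : K :=
  l.foldr (fun b y => if b then J y else A y) k

/-- The vectors orthogonal to the orbit of a family under all words in `J` and `A`. -/
noncomputable def orbitOrthogonal {κ : Type w} (J A : K →L[ℂ] K) (x : κ → K) : Submodule ℂ K :=
  (Submodule.span ℂ (Set.range fun q : List Bool × κ => wordApply J A q.1 (x q.2)))ᗮ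

theorem mem_orbitOrthogonal {κ : Type w} {J A : K →L[ℂ] K} {x : κ → K} {k : K} :
    k ∈ orbitOrthogonal J A x ↔
      ∀ q : List Bool × κ, inner ℂ (wordApply J A q.1 (x q.2)) k = 0 := by
  rw [orbitOrthogonal, Submodule.mem_orthogonal]
  refine ⟨fun h q => h _ (Submodule.subset_span ⟨q, rfl⟩), fun h u hu => ?_⟩
  induction hu using Submodule.span_induction with
  | mem _ hx => obtain ⟨q, rfl⟩ := hx; exact h q
  | zero => exact inner_zero_left _
  | add _ _ _ _ h₁ h₂ => rw [inner_add_left, h₁, h₂, add_zero]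
  | smul a _ _ h₁ => rw [inner_smul_left, h₁, mul_zero]

end Orbit

/-! ### Bounding the positive index of `J` by that of `T* J T` -/

section Factorization

variable {H : Type u} [NormedAddCommGroup H] [InnerProductSpace ℂ H] [CompleteSpace H]
  {K : Type v} [NormedAddCommGroup K] [InnerProductSpace ℂ K] [CompleteSpace K]

/-- If the positive spectral subspace `P` of `T* J T` is finite-dimensional, then `J` is
nonpositive on the orthogonal complement of `J T P`. -/
theorem nonpos_of_finiteDimensional {C : H →L[ℂ] H} (hC : IsSelfAdjoint C)
    (hker : ∀ f, C f = 0 → f = 0) {J : K →L[ℂ] K} (hJ : IsSelfAdjoint J) {T : H →L[ℂ] K}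
    (hT : DenseRange T) (hfac : C = adjoint T ∘L J ∘L T)
    {P : Submodule ℂ H} [FiniteDimensional ℂ P] (hinv : ∀ f ∈ P, C f ∈ P)
    (hneg : ∀ f ∈ Pᗮ, (inner ℂ (C f) f).re ≤ 0) {k : K}
    (hk : ∀ f ∈ P, inner ℂ (J (T f)) k = 0) : (inner ℂ (J k) k).re ≤ 0 := by
  have hform (f : H) : inner ℂ (C f) f = inner ℂ (J (T f)) (T f) := by
    rw [hfac, comp_apply, comp_apply, adjoint_inner_left]
  let S₀ : P →ₗ[ℂ] P := C.toLinearMap.restrict hinv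
  have hS₀ : Function.Injective S₀ := by
    rw [injective_iff_map_eq_zero]
    exact fun f hf => Subtype.ext (hker f (congrArg Subtype.val hf))
  -- Finite dimension is essential here: it turns injectivity of `C` on `P` into bounded
  -- invertibility.
  let S : P ≃L[ℂ] P := (LinearEquiv.ofInjectiveEndo S₀ hS₀).toContinuousLinearEquiv
  let p : H →L[ℂ] P := P.orthogonalProjectionOnto
  -- `G` is the `J`-orthogonal projection along `T P`. It satisfies `G T = T (1 - p)`, so `J` is
  -- nonpositive on its range by density, and it fixes every vector orthogonal to `J T P`.
  let G : K →L[ℂ] K := ContinuousLinearMap.id ℂ K -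
    T ∘L P.subtypeL ∘L (S.symm : P →L[ℂ] P) ∘L p ∘L adjoint T ∘L J
  have hGT (h : H) : G (T h) = T (h - p h) := by
    -- Since `C` is selfadjoint and leaves `P` invariant, it commutes with the projection.
    have hpC : p (C h) = S (p h) := by
      refine ext_inner_right ℂ fun e => ?_
      have hS : ((S (p h) : P) : H) = C (p h) := rfl
      rw [Submodule.inner_orthogonalProjectionOnto_eq_of_mem_right, Submodule.coe_inner, hS,
        IsSelfAdjoint.inner_left_eq hC, IsSelfAdjoint.inner_left_eq hC]
      exact (Submodule.inner_orthogonalProjectionOnto_eq_of_mem_right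
        (⟨C e, hinv e e.2⟩ : P) h).symm
    have hTJT : adjoint T (J (T h)) = C h := by rw [hfac]; rfl
    change T h - T (S.symm (p (adjoint T (J (T h)))) : P) = _
    rw [hTJT, hpC, S.symm_apply_apply, map_sub]
  have hG (x : K) : (inner ℂ (J (G x)) (G x)).re ≤ 0 := by
    refine hT.induction_on (p := fun x => (inner ℂ (J (G x)) (G x)).re ≤ 0) x
      (isClosed_le (by fun_prop) continuous_const) fun h => ?_
    rw [hGT, ← hform]
    exact hneg _ (P.sub_starProjection_mem_orthogonal h)
  have hpk : p (adjoint T (J k)) = 0 := by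
    refine ext_inner_left ℂ fun e => ?_
    rw [Submodule.inner_orthogonalProjectionOnto_eq_of_mem_left, adjoint_inner_right,
      ← IsSelfAdjoint.inner_left_eq hJ, hk e e.2, inner_zero_right]
  have hGk : G k = k := by
    change k - T (S.symm (p (adjoint T (J k))) : P) = k
    rw [hpk]
    simp
  simpa only [hGk] using hG k

/-- An injective selfadjoint operator maps an invariant closed subspace densely into itself. -/
theorem le_topologicalClosure_map {A : K →L[ℂ] K} (hA : IsSelfAdjoint A)
    (hker : ∀ k, A k = 0 → k = 0) {N : Submodule ℂ K} (hN : IsClosed (N : Set K))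
    (hinv : ∀ k ∈ N, A k ∈ N) : N ≤ (N.map A.toLinearMap).topologicalClosure := by
  set R := (N.map A.toLinearMap).topologicalClosure with hR
  have hRN : R ≤ N := Submodule.topologicalClosure_minimal _
    (by rintro _ ⟨k, hk, rfl⟩; exact hinv k hk) hN
  have hAR (k : K) (hk : k ∈ N) : A k ∈ R :=
    Submodule.le_topologicalClosure _ ⟨k, hk, rfl⟩
  have : CompleteSpace R := (Submodule.isClosed_topologicalClosure _).completeSpace_coe
  intro k hk
  let u := k - R.starProjection k
  have hu : u ∈ N := N.sub_mem hk (hRN (R.starProjection_apply_mem k))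
  have huR : u ∈ Rᗮ := R.sub_starProjection_mem_orthogonal k
  -- `‖A u‖² = ⟨A (A u), u⟩ = 0`, since `A (A u)` lies in `R` and `u` in `Rᗮ`.
  have hu0 : u = 0 := by
    refine hker u ?_
    rw [← inner_self_eq_zero (𝕜 := ℂ), ← IsSelfAdjoint.inner_left_eq hA]
    exact huR _ (hAR _ (hinv _ hu))
  rw [sub_eq_zero.1 hu0]
  exact R.starProjection_apply_mem k

/-- `J` is nonpositive on every closed subspace orthogonal to `T P` that is invariant under `J`
and `T T*`, where `P` is the positive spectral subspace of `T* J T`. -/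
theorem nonpos_of_invariant {C : H →L[ℂ] H} {J : K →L[ℂ] K} {T : H →L[ℂ] K}
    (hTker : ∀ f, T f = 0 → f = 0)
    (hT : DenseRange T) (hfac : C = adjoint T ∘L J ∘L T) {P : Submodule ℂ H}
    (hneg : ∀ f ∈ Pᗮ, (inner ℂ (C f) f).re ≤ 0) {N : Submodule ℂ K} (hN : IsClosed (N : Set K))
    (hinv : ∀ k ∈ N, T (adjoint T k) ∈ N) (hNP : ∀ k ∈ N, adjoint T k ∈ Pᗮ) {k : K}
    (hk : k ∈ N) : (inner ℂ (J k) k).re ≤ 0 := by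
  have hA : IsSelfAdjoint (T ∘L adjoint T) := (isPositive_self_comp_adjoint T).isSelfAdjoint
  have hAker (y : K) (hy : (T ∘L adjoint T) y = 0) : y = 0 := by
    have h0 : adjoint T y = 0 := hTker _ hy
    refine hT.eq_zero_of_inner_left ℂ ?_
    intro h
    rw [← adjoint_inner_left, h0, inner_zero_left]
  have hmem := le_topologicalClosure_map hA hAker hN hinv hk
  have hclosed : IsClosed {x : K | (inner ℂ (J x) x).re ≤ 0} :=
    isClosed_le (by fun_prop) continuous_const
  refine closure_minimal ?_ hclosed hmem
  -- On the dense part `T T* N` the form of `J` is that of `C` at `T* y ∈ Pᗮ`.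
  rintro _ ⟨y, hy, rfl⟩
  have h := hneg _ (hNP y hy)
  rwa [hfac, comp_apply, comp_apply, adjoint_inner_left] at h

theorem apply_mem_orbitOrthogonal {κ : Type w} {J A : K →L[ℂ] K} (hA : IsSelfAdjoint A)
    {x : κ → K} {k : K} (hk : k ∈ orbitOrthogonal J A x) : A k ∈ orbitOrthogonal J A x := by
  rw [mem_orbitOrthogonal] at hk ⊢
  intro q
  rw [← IsSelfAdjoint.inner_left_eq hA]
  -- The letter `false` stands for `A`, so moving `A` across the inner product only lengthens the
  -- word.
  exact hk (false :: q.1, q.2)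

/-- There are no more than `dim P` vectors on whose orthogonal complement `J` is nonpositive,
where `P` is the positive spectral subspace of `T* J T`. -/
theorem exists_family_nonpos {C : H →L[ℂ] H} (hC : IsSelfAdjoint C)
    (hker : ∀ f, C f = 0 → f = 0) {J : K →L[ℂ] K} (hJ : IsSelfAdjoint J) {T : H →L[ℂ] K}
    (hTker : ∀ f, T f = 0 → f = 0) (hT : DenseRange T) (hfac : C = adjoint T ∘L J ∘L T)
    {P : Submodule ℂ H} (hP : IsClosed (P : Set H)) (hinv : ∀ f ∈ P, C f ∈ P)
    (hneg : ∀ f ∈ Pᗮ, (inner ℂ (C f) f).re ≤ 0) :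
    ∃ (κ : Type u) (x : κ → K), #κ = hilbertDim P ∧
      ∀ k, (∀ j, inner ℂ (x j) k = 0) → (inner ℂ (J k) k).re ≤ 0 := by
  have := hP.completeSpace_coe
  obtain ⟨κ, c, hc⟩ := exists_hilbertBasis_mk_eq P
  have hext (g : H) (hg : ∀ j, inner ℂ (c j : H) g = 0) : g ∈ Pᗮ := by
    rw [← Submodule.orthogonalProjectionOnto_eq_zero_iff]
    have hr : c.repr (P.orthogonalProjectionOnto g) = 0 := by
      ext j
      rw [c.repr_apply_apply, Submodule.inner_orthogonalProjectionOnto_eq_of_mem_left, hg j]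
      rfl
    simpa using hr
  rcases finite_or_infinite κ with hκ | hκ
  · have := Fintype.ofFinite κ
    have : FiniteDimensional ℂ P := c.toOrthonormalBasis.toBasis.finiteDimensional_of_finite
    refine ⟨κ, fun j => J (T (c j)), hc, fun k hk => ?_⟩
    refine nonpos_of_finiteDimensional hC hker hJ hT hfac hinv hneg fun f hf => ?_
    have hmem : adjoint T (J k) ∈ Pᗮ := hext _ fun j => by
      rw [adjoint_inner_right, ← IsSelfAdjoint.inner_left_eq hJ, hk j]
    rw [IsSelfAdjoint.inner_left_eq hJ, ← adjoint_inner_right]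
    exact hmem f hf
  · let A : K →L[ℂ] K := T ∘L adjoint T
    have hA : IsSelfAdjoint A := (isPositive_self_comp_adjoint T).isSelfAdjoint
    let x : κ → K := fun j => T (c j)
    refine ⟨List Bool × κ, fun q => wordApply J A q.1 (x q.2), ?_, fun k hk => ?_⟩
    · rw [← hc, mk_prod, lift_uzero, mk_list_eq_aleph0, lift_aleph0, aleph0_mul_eq (aleph0_le_mk κ)]
    · refine nonpos_of_invariant hTker hT hfac hneg (N := orbitOrthogonal J A x)
        (Submodule.isClosed_orthogonal _) (fun y hy => apply_mem_orbitOrthogonal hA hy)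
        (fun y hy => hext _ fun j => ?_) (mem_orbitOrthogonal.2 hk)
      rw [adjoint_inner_right]
      -- The empty word gives `T (c j)` itself.
      exact mem_orbitOrthogonal.1 hy ([], j)

/-- The positive indices of `J` and `T* J T` are attained and agree. -/
theorem posIndex_factorization {C : H →L[ℂ] H} (hC : IsSelfAdjoint C)
    (hker : ∀ f, C f = 0 → f = 0) {J : K →L[ℂ] K} (hJ : IsSelfAdjoint J)
    (hJker : ∀ k, J k = 0 → k = 0) {T : H →L[ℂ] K}
    (hTker : ∀ f, T f = 0 → f = 0) (hT : DenseRange T) (hfac : C = adjoint T ∘L J ∘L T) :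
    IsGreatest (posDims C) (posIndex C) ∧ IsGreatest (posDims J) (posIndex J) ∧
      lift.{v} (posIndex C) = lift.{u} (posIndex J) := by
  obtain ⟨P, hP, hPinv, hPpos, hPneg⟩ := exists_positive_spectral_subspace hC hker
  obtain ⟨Q, hQ, -, hQpos, hQneg⟩ := exists_positive_spectral_subspace hJ hJker
  have hCP := isGreatest_posDims hP hPpos hPneg
  have hJQ := isGreatest_posDims hQ hQpos hQneg
  have hiC : posIndex C = hilbertDim P := hCP.csSup_eq
  have hiJ : posIndex J = hilbertDim Q := hJQ.csSup_eq
  rw [hiC, hiJ]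
  refine ⟨hCP, hJQ, le_antisymm ?_ ?_⟩
  · refine hilbertDim_le_of_form_le T (fun f => ?_) hQ hQneg hP hPpos
    rw [hfac, comp_apply, comp_apply, adjoint_inner_left]
  · obtain ⟨κ, x, hκ, hx⟩ := exists_family_nonpos hC hker hJ hTker hT hfac hP hPinv hPneg
    rw [← hκ]
    exact hilbertDim_le_of_nonpos hQ hQpos x hx

end Factorization

end HermitianIndices

open HermitianIndices in
theorem theorem2p7
    {H : Type u} [NormedAddCommGroup H] [InnerProductSpace ℂ H] [CompleteSpace H]
    {K : Type v} [NormedAddCommGroup K] [InnerProductSpace ℂ K] [CompleteSpace K]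
    (C : H →L[ℂ] H) (hC : IsSelfAdjoint C) (hCker : ∀ f : H, C f = 0 → f = 0)
    (J : K →L[ℂ] K) (hJ : IsSignatureOperator J)
    (T : H →L[ℂ] K) (hTker : ∀ f : H, T f = 0 → f = 0) (hTdense : DenseRange T)
    (hfac : C = ContinuousLinearMap.adjoint T ∘L J ∘L T) :
    -- the four indices are attained maxima
    (IsGreatest (posDims C) (posIndex C) ∧ IsGreatest (negDims C) (negIndex C) ∧
      IsGreatest (posDims J) (posIndex J) ∧ IsGreatest (negDims J) (negIndex J)) ∧
    -- and they agree (as cardinals, compared in a common universe)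
    Cardinal.lift.{v} (posIndex C) = Cardinal.lift.{u} (posIndex J) ∧
    Cardinal.lift.{v} (negIndex C) = Cardinal.lift.{u} (negIndex J) := by
  have hJker : ∀ k : K, J k = 0 → k = 0 := fun k hk => by
    have h : star J (J k) = k := DFunLike.congr_fun (Unitary.star_mul_self_of_mem hJ.2) k
    rw [← h, hk, map_zero]
  obtain ⟨h₁, h₂, h₃⟩ := posIndex_factorization hC hCker hJ.1 hJker hTker hTdense hfac
  -- The negative indices are the positive indices of `-C` and `-J`, which satisfy the same
  -- factorization.
  have hneg : -C = ContinuousLinearMap.adjoint T ∘L (-J) ∘L T := by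
    ext f
    simp [hfac]
  obtain ⟨h₄, h₅, h₆⟩ := posIndex_factorization hC.neg (by simpa using hCker) hJ.1.neg
    (by simpa using hJker) hTker hTdense hneg
  simp only [negDims_eq_posDims_neg, negIndex_eq_posIndex_neg]
  exact ⟨⟨h₁, h₄, h₂, h₅⟩, h₃, h₆⟩
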